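/- Let $Y$ be a Polish space (a separable, completely metrizable topological space), and let $\omega^\omega$ be the Baire space, that is, the set of all functions $\omega\to\omega$ with the product topology, where $\omega$ is discrete. Say that $\omega^\omega\times Y$ has UU if there is an open set $U\subseteq\omega^\omega\times Y$ such that for every open set $W\subseteq Y$ there is exactly one $x\in\omega^\omega$ with $U_x=W$, where $U_x=\{y\in Y : (x,y)\in U\}$. Then $\omega^\omega\times Y$ has UU if and only if $Y$ is not compact. -/

import Mathlib

/-- The cross section `U_x = {y ∈ Y : (x, y) ∈ U}` of a set `U ⊆ X × Y` at `x`. -/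
def crossSection {X Y : Type*} (U : Set (X × Y)) (x : X) : Set Y :=
  {y | (x, y) ∈ U}

/-- `U ⊆ X × Y` is uniquely universal for the open subsets of `Y`: it is open, and every open
`W ⊆ Y` is the cross section of `U` at exactly one point `x ∈ X`. -/
def IsUniquelyUniversal {X Y : Type*} [TopologicalSpace X] [TopologicalSpace Y]
    (U : Set (X × Y)) : Prop :=
  IsOpen U ∧ ∀ W : Set Y, IsOpen W → ∃! x : X, crossSection U x = W

/-- `X × Y` satisfies UU: there is a subset of `X × Y` that is uniquely universal for the open
subsets of `Y`. -/
def HasUU (X Y : Type*) [TopologicalSpace X] [TopologicalSpace Y] : Prop :=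
  ∃ U : Set (X × Y), IsUniquelyUniversal U

/-! If `Y` is compact, the tube lemma makes `U_x = Y` an open condition on `x`. It cannot then hold
at exactly one point, since the Baire space has no isolated points.

If `Y` is not compact, fix a countable basis `b` of nonempty sets with no finite subcover, and code
an open `W` by the set of members of `b` inside it. The codes form a `Gδ` subset of the Cantor cube
`b → Bool` (`isGδ_openCodes`), hence a zero-dimensional Polish space. The absence of finite
subcovers rules out isolated points (`perfectSpace_openCodes`). Such a space is a continuous
bijective image of the Baire space (`exists_nat_nat_continuous_bijective`). Composing with decoding
gives `U`: continuity makes it open, and bijectivity makes each section occur exactly once. -/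

open Set Filter Topology TopologicalSpace

/-! ### Continuous bijections from the Baire space -/

/-- A nonempty perfect set in a complete metric space contains a nonempty perfect subset that is
not relatively open. -/
theorem Perfect.exists_perfect_subset_inter_closure_diff {X : Type*} [MetricSpace X]
    [CompleteSpace X] {A : Set X} (hA : Perfect A) (hne : A.Nonempty) :
    ∃ C ⊆ A, Perfect C ∧ (C ∩ closure (A \ C)).Nonempty := by
  obtain ⟨f, hfA, hfc, hfi⟩ := hA.exists_nat_bool_injection hne
  -- Flipping a late odd coordinate stays in `E`, so the image is perfect; flipping a late even one
  -- leaves `E`, so the image is not relatively open.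
  set E : Set (ℕ → Bool) := {x | ∀ n, x (2 * n) = false} with hE
  have hEc : IsClosed E := by
    simp only [hE, ofPred_forall]
    exact isClosed_iInter fun n => isClosed_eq (continuous_apply _) continuous_const
  have flip : ∀ (x : ℕ → Bool) (k : ℕ → ℕ), StrictMono k →
      Tendsto (fun n => Function.update x (k n) (!x (k n))) atTop (𝓝 x) := by
    intro x k hk
    rw [tendsto_pi_nhds]
    intro i
    apply tendsto_const_nhds.congr'
    filter_upwards [eventually_gt_atTop i] with n hn
    rw [Function.update_of_ne (hn.trans_le (hk.id_le n)).ne]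
  refine ⟨f '' E, (image_subset_range _ _).trans hfA,
    ⟨(hEc.isCompact.image hfc).isClosed, ?_⟩, f fun _ => false, ⟨_, fun _ => rfl, rfl⟩, ?_⟩
  · rw [preperfect_iff_nhds]
    rintro _ ⟨x, hx, rfl⟩ U hU
    have hk : StrictMono fun n : ℕ => 2 * n + 1 := fun a b h => by dsimp only; omega
    obtain ⟨n, hn⟩ := (((hfc.tendsto x).comp (flip x _ hk)).eventually_mem hU).exists
    refine ⟨_, ⟨hn, _, fun m => ?_, rfl⟩, fun h => ?_⟩
    · dsimp only
      rw [Function.update_of_ne (by omega)]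
      exact hx m
    · simpa using congrFun (hfi h) (2 * n + 1)
  · have hk : StrictMono fun n : ℕ => 2 * n := fun a b h => by dsimp only; omega
    refine mem_closure_of_tendsto ((hfc.tendsto _).comp (flip _ _ hk))
      (Eventually.of_forall fun n => ⟨hfA (mem_range_self _), ?_⟩)
    rintro ⟨y, hy, hyx⟩
    have h := hy n
    rw [hfi hyx] at h
    simp at h

/-- In a second-countable metric space with a basis of clopen sets, every open set is a countable
disjoint union of clopen sets of small diameter. -/
theorem IsOpen.exists_isClopen_partition {X : Type*} [MetricSpace X] [SecondCountableTopology X]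
    (hX : IsTopologicalBasis {s : Set X | IsClopen s}) {O : Set X} (hO : IsOpen O) {ε : ENNReal}
    (hε : 0 < ε) :
    ∃ V : ℕ → Set X, (∀ n, IsClopen (V n)) ∧ Pairwise (Function.onFun Disjoint V) ∧
      ⋃ n, V n = O ∧ ∀ n, Metric.ediam (V n) ≤ ε := by
  set S : Set (Set X) := {s | IsClopen s ∧ s ⊆ O ∧ Metric.ediam s ≤ ε} with hS
  obtain ⟨T, hTc, hTS, hTU⟩ := isOpen_sUnion_countable S fun s hs => hs.1.isOpen
  have hSO : ⋃₀ S = O := by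
    refine subset_antisymm (sUnion_subset fun s hs => hs.2.1) fun x hx => ?_
    obtain ⟨s, hs, hxs, hsO⟩ := hX.mem_nhds_iff.1
      (inter_mem (hO.mem_nhds hx) (Metric.eball_mem_nhds x (ENNReal.half_pos hε.ne')))
    refine ⟨s, ⟨hs, fun y hy => (hsO hy).1, ?_⟩, hxs⟩
    calc Metric.ediam s ≤ Metric.ediam (Metric.eball x (ε / 2)) :=
          Metric.ediam_mono fun y hy => (hsO hy).2
      _ ≤ 2 * (ε / 2) := Metric.ediam_eball_le
      _ = ε := ENNReal.mul_div_cancel two_ne_zero ENNReal.ofNat_ne_top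
  -- Adding `∅` makes the family nonempty, so that `ℕ` can enumerate it.
  have hT' : ∀ s ∈ insert ∅ T, s ∈ S := by
    rintro s (rfl | hs)
    · exact ⟨isClopen_empty, empty_subset _, by simp⟩
    · exact hTS hs
  obtain ⟨v, hv⟩ := (hTc.insert ∅).exists_eq_range (insert_nonempty _ _)
  have hvS : ∀ n, v n ∈ S := fun n => hT' _ (hv ▸ mem_range_self n)
  refine ⟨disjointed v, fun n => ?_, disjoint_disjointed v, ?_, fun n =>
    (Metric.ediam_mono (disjointed_le v n)).trans (hvS n).2.2⟩
  · exact disjointedRec (p := IsClopen) (fun _ i h => h.diff (hvS i).1) (hvS n).1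
  · rw [iUnion_disjointed, ← sUnion_range, ← hv, sUnion_insert, empty_union, hTU, hSO]

/-- In a complete separable metric space with a basis of clopen sets, every nonempty perfect set
splits into infinitely many nonempty perfect sets of small diameter. -/
theorem Perfect.exists_nat_partition {X : Type*} [MetricSpace X] [CompleteSpace X]
    [SecondCountableTopology X] (hX : IsTopologicalBasis {s : Set X | IsClopen s}) {A : Set X}
    (hA : Perfect A) (hne : A.Nonempty) {ε : ENNReal} (hε : 0 < ε) :
    ∃ B : ℕ → Set X, (∀ n, Perfect (B n) ∧ (B n).Nonempty ∧ Metric.ediam (B n) ≤ ε) ∧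
      Pairwise (Function.onFun Disjoint B) ∧ ⋃ n, B n = A := by
  have inter : ∀ {Q : Set X}, IsClopen Q → Perfect (Q ∩ A) := fun hQ =>
    ⟨hQ.isClosed.inter hA.closed, hA.acc.open_inter hQ.isOpen⟩
  -- Choosing `C` inside one small piece `W i` bounds its diameter.
  obtain ⟨W, hWc, -, hWU, hWd⟩ := isOpen_univ.exists_isClopen_partition hX hε
  obtain ⟨x, hx⟩ := hne
  obtain ⟨i, hi⟩ := mem_iUnion.1 (hWU.symm ▸ mem_univ x)
  obtain ⟨C, hCA, hC, p, hpC, hp⟩ :=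
    (inter (hWc i)).exists_perfect_subset_inter_closure_diff ⟨x, hi, hx⟩
  replace hp : p ∈ closure (A \ C) :=
    closure_mono (sdiff_subset_sdiff_left inter_subset_right) hp
  obtain ⟨V, hVc, hVd, hVU, hVε⟩ := hC.closed.isOpen_compl.exists_isClopen_partition hX hε
  have hAC : A \ C = ⋃ n, V n ∩ A := by
    rw [← iUnion_inter, hVU, inter_comm, sdiff_eq]
  -- With finitely many pieces `A \ C` would be closed, yet `p ∈ C` is in its closure.
  have hinf : {n | (V n ∩ A).Nonempty}.Infinite := by
    intro hfin
    have hcl : IsClosed (A \ C) := by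
      have : A \ C = ⋃ n ∈ {n | (V n ∩ A).Nonempty}, V n ∩ A := by
        rw [hAC]
        ext y
        simp only [mem_iUnion, exists_prop]
        exact ⟨fun ⟨n, h⟩ => ⟨n, ⟨y, h⟩, h⟩, fun ⟨n, _, h⟩ => ⟨n, h⟩⟩
      rw [this]
      exact hfin.isClosed_biUnion fun n _ => (inter (hVc n)).closed
    exact (hcl.closure_eq ▸ hp).2 hpC
  have := hinf.to_subtype
  obtain ⟨e⟩ : Nonempty (ℕ ≃ {n | (V n ∩ A).Nonempty}) := nonempty_equiv_of_countable
  have hdC : ∀ n, Disjoint C (V n ∩ A) := fun n => by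
    refine disjoint_left.2 fun y hy hy' => ?_
    have : y ∈ Cᶜ := hVU ▸ mem_iUnion.2 ⟨n, hy'.1⟩
    exact this hy
  refine ⟨fun n => n.casesOn C fun k => V (e k) ∩ A, ?_, ?_, ?_⟩
  · rintro (_ | k)
    · exact ⟨hC, ⟨p, hpC⟩, (Metric.ediam_mono (hCA.trans inter_subset_left)).trans (hWd i)⟩
    · exact ⟨inter (hVc _), (e k).2, (Metric.ediam_mono inter_subset_left).trans (hVε _)⟩
  · rintro (_ | k) (_ | l) hkl
    · exact absurd rfl hkl
    · exact hdC _
    · exact (hdC _).symm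
    · refine (hVd fun h => hkl ?_).mono inter_subset_left inter_subset_left
      rw [e.injective (Subtype.ext h)]
  · ext y
    rw [mem_iUnion]
    constructor
    · rintro ⟨_ | k, hk⟩
      · exact (hCA hk).2
      · exact hk.2
    · intro hy
      by_cases hyC : y ∈ C
      · exact ⟨0, hyC⟩
      · obtain ⟨n, hn⟩ := mem_iUnion.1 (hAC.subset ⟨hy, hyC⟩)
        obtain ⟨k, hk⟩ := e.surjective ⟨n, y, hn⟩
        exact ⟨k + 1, by simpa [hk] using hn⟩

/-- Every nonempty zero-dimensional Polish space without isolated points is a continuous bijective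
image of the Baire space. -/
theorem exists_nat_nat_continuous_bijective (X : Type*) [TopologicalSpace X] [PolishSpace X]
    [Nonempty X] [PerfectSpace X] (hX : IsTopologicalBasis {s : Set X | IsClopen s}) :
    ∃ f : (ℕ → ℕ) → X, Continuous f ∧ Function.Bijective f := by
  let := upgradeIsCompletelyMetrizable X
  obtain ⟨u, -, hu0, hu⟩ := exists_seq_strictAnti_tendsto' (zero_lt_one' ENNReal)
  let P := Subtype fun E : Set X => Perfect E ∧ E.Nonempty
  have split : ∀ (n : ℕ) (E : P), ∃ B : ℕ → P, (∀ k, Metric.ediam (B k).1 ≤ u n) ∧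
      Pairwise (Function.onFun Disjoint fun k => (B k).1) ∧ ⋃ k, (B k).1 = E.1 := by
    intro n E
    obtain ⟨B, hB, hd, hU⟩ := E.2.1.exists_nat_partition hX E.2.2 (hu0 n).1
    exact ⟨fun k => ⟨B k, (hB k).1, (hB k).2.1⟩, fun k => (hB k).2.2, hd, hU⟩
  choose B hBε hBd hBU using split
  let D : List ℕ → P := fun l =>
    l.rec ⟨univ, PerfectSpace.univ_perfect X, univ_nonempty⟩ fun a l ih => B l.length ih a
  let A : List ℕ → Set X := fun l => (D l).1
  have hdisj : CantorScheme.Disjoint A := fun l a b hab => hBd l.length (D l) hab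
  have hmem : ∀ (l : List ℕ) (y : X), y ∈ A l → ∃ a, y ∈ A (a :: l) := fun l y hy =>
    mem_iUnion.1 ((hBU l.length (D l)).symm ▸ hy)
  have hanti : CantorScheme.ClosureAntitone A :=
    CantorScheme.Antitone.closureAntitone
      (fun l a => (subset_iUnion (fun k => (B l.length (D l) k).1) a).trans_eq (hBU _ _))
      fun l => (D l).2.1.closed
  have hdiam : CantorScheme.VanishingDiam A := by
    intro x
    -- The bound `u n` applies at level `n + 1`; the root is the whole space, with no diameter
    -- bound.
    rw [← tendsto_add_atTop_iff_nat 1]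
    refine tendsto_of_tendsto_of_tendsto_of_le_of_le tendsto_const_nhds hu (fun _ => zero_le)
      fun n => ?_
    rw [PiNat.res_succ]
    refine (hBε (PiNat.res x n).length (D (PiNat.res x n)) (x n)).trans_eq ?_
    rw [PiNat.res_length]
  have htot := hanti.map_of_vanishingDiam hdiam fun l => (D l).2.2
  have hdom : ∀ x, x ∈ (CantorScheme.inducedMap A).1 := fun x => htot ▸ mem_univ x
  refine ⟨fun x => (CantorScheme.inducedMap A).2 ⟨x, hdom x⟩,
    hdiam.map_continuous.comp (by fun_prop), fun x y hxy =>
      congrArg Subtype.val (hdisj.map_injective hxy), fun y => ?_⟩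
  -- Surjectivity: follow the branch of pieces containing `y`.
  choose next hnext using fun l : {l // y ∈ A l} => hmem l.1 y l.2
  let L : ℕ → {l // y ∈ A l} := fun n =>
    n.rec ⟨[], mem_univ y⟩ fun _ l => ⟨next l :: l.1, hnext l⟩
  have hL : ∀ n, PiNat.res (fun n => next (L n)) n = (L n).1 := by
    intro n
    induction n with
    | zero => rfl
    | succ n ih => rw [PiNat.res_succ, ih]
  refine ⟨fun n => next (L n), ?_⟩
  refine eq_of_forall_dist_le fun ε hε => ?_
  obtain ⟨n, hn⟩ := hdiam.dist_lt ε hε fun n => next (L n)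
  exact (hn _ (CantorScheme.map_mem _ n) _ (hL n ▸ (L n).2)).le

/-! ### Subspaces and the choice of basis -/

/-- A `Gδ` subset of a Polish space is Polish. -/
theorem IsGδ.polishSpace {X : Type*} [TopologicalSpace X] [PolishSpace X] {s : Set X}
    (hs : IsGδ s) : PolishSpace s := by
  obtain ⟨U, hUo, rfl⟩ := isGδ_iff_eq_iInter_nat.1 hs
  have := fun n => (hUo n).polishSpace
  have hmem : ∀ (x : ⋂ n, U n) n, (x : X) ∈ U n := fun x => mem_iInter.1 x.2
  let g : (⋂ n, U n) → ∀ n, U n := fun x n => ⟨x, hmem x n⟩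
  have hg : Continuous g := by fun_prop
  have hemb : IsEmbedding g := by
    refine IsEmbedding.of_comp hg (g := fun f => (f 0 : X)) (by fun_prop) ?_
    exact IsEmbedding.subtypeVal
  -- The diagonal embedding into `∀ n, U n` has closed range.
  have hrange : range g = ⋂ n, {f | (f n : X) = f 0} := by
    ext f
    simp only [mem_range, mem_iInter, mem_ofPred_eq]
    constructor
    · rintro ⟨x, rfl⟩ n
      rfl
    · intro h
      exact ⟨⟨f 0, mem_iInter.2 fun n => h n ▸ (f n).2⟩, funext fun n => Subtype.ext (h n).symm⟩
  have hcl : IsClosedEmbedding g := by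
    refine ⟨hemb, hrange ▸ isClosed_iInter fun n => ?_⟩
    exact isClosed_eq (by fun_prop) (by fun_prop)
  exact hcl.polishSpace

/-- A space induced from one with a basis of clopen sets has a basis of clopen sets. -/
theorem Topology.IsInducing.isTopologicalBasis_isClopen {X Z : Type*} [TopologicalSpace X]
    [TopologicalSpace Z] {f : X → Z} (hf : IsInducing f)
    (hZ : IsTopologicalBasis {s : Set Z | IsClopen s}) :
    IsTopologicalBasis {s : Set X | IsClopen s} := by
  refine isTopologicalBasis_of_isOpen_of_nhds (fun s hs => hs.isOpen) fun a u ha hu => ?_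
  obtain ⟨v, hv, rfl⟩ := hf.isOpen_iff.1 hu
  obtain ⟨s, hs, has, hsv⟩ := hZ.exists_subset_of_mem_open ha hv
  exact ⟨f ⁻¹' s, hs.preimage hf.continuous, has, preimage_mono hsv⟩

/-- A second-countable noncompact space has a countable basis of nonempty sets no finite subfamily
of which covers the space. -/
theorem exists_countable_basis_forall_finite_sUnion_ne_univ (Y : Type*) [TopologicalSpace Y]
    [SecondCountableTopology Y] (hY : ¬ CompactSpace Y) :
    ∃ b : Set (Set Y), b.Countable ∧ IsTopologicalBasis b ∧ (∀ s ∈ b, s.Nonempty) ∧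
      ∀ t ⊆ b, t.Finite → ⋃₀ t ≠ univ := by
  have : ∃ (ι : Type _) (U : ι → Set Y), (∀ i, IsOpen (U i)) ∧ univ ⊆ ⋃ i, U i ∧
      ∀ t : Finset ι, ¬ univ ⊆ ⋃ i ∈ t, U i := by
    by_contra! h
    refine hY ⟨isCompact_of_finite_subcover fun U hU hc => h _ U hU hc⟩
  obtain ⟨ι, U, hUo, hUc, hUf⟩ := this
  refine ⟨{s ∈ countableBasis Y | ∃ i, s ⊆ U i}, (countable_countableBasis Y).mono (sep_subset _ _),
    ?_, fun s hs => nonempty_of_mem_countableBasis hs.1, ?_⟩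
  · refine isTopologicalBasis_of_isOpen_of_nhds
      (fun s hs => isOpen_of_mem_countableBasis hs.1) fun a u ha hu => ?_
    obtain ⟨i, hi⟩ := mem_iUnion.1 (hUc (mem_univ a))
    obtain ⟨s, hs, has, hsu⟩ := (isBasis_countableBasis Y).exists_subset_of_mem_open
      (show a ∈ u ∩ U i from ⟨ha, hi⟩) (hu.inter (hUo i))
    exact ⟨s, ⟨hs, i, hsu.trans inter_subset_right⟩, has, hsu.trans inter_subset_left⟩
  · intro t htb htf htU
    have : Nonempty ι := by
      obtain ⟨y, -, -⟩ := not_subset.1 (hUf ∅)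
      exact ⟨(mem_iUnion.1 (hUc (mem_univ y))).choose⟩
    choose! i hi using show ∀ s ∈ t, ∃ i, s ⊆ U i from fun s hs => (htb hs).2
    classical
    refine hUf (htf.toFinset.image i) fun y _ => ?_
    obtain ⟨s, hs, hy⟩ := mem_sUnion.1 (htU.symm ▸ mem_univ y)
    exact mem_biUnion (Finset.mem_coe.2 (Finset.mem_image_of_mem i (htf.mem_toFinset.2 hs)))
      (hi s hs hy)

/-! ### The space of codes of open sets -/

section BasisCode

variable {Y : Type*}

open Classical in
/-- The code of a set `W` relative to a family `b` records which members of `b` lie in `W`. -/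
noncomputable def basisCode (b : Set (Set Y)) (W : Set Y) : b → Bool :=
  fun s => decide ((s : Set Y) ⊆ W)

theorem basisCode_eq_true {b : Set (Set Y)} {W : Set Y} {s : b} :
    basisCode b W s = true ↔ (s : Set Y) ⊆ W := by
  simp [basisCode]

theorem basisCode_eq_false {b : Set (Set Y)} {W : Set Y} {s : b} :
    basisCode b W s = false ↔ ¬ (s : Set Y) ⊆ W := by
  simp [basisCode]

variable [TopologicalSpace Y]

/-- The codes of the open sets. -/
def openCodes (b : Set (Set Y)) : Set (b → Bool) := basisCode b '' {W | IsOpen W}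

theorem mem_iff_exists_basisCode {b : Set (Set Y)} (hb : IsTopologicalBasis b) {W : Set Y}
    (hW : IsOpen W) {y : Y} : y ∈ W ↔ ∃ s : b, basisCode b W s = true ∧ y ∈ (s : Set Y) := by
  constructor
  · intro hy
    obtain ⟨s, hs, hys, hsW⟩ := hb.exists_subset_of_mem_open hy hW
    exact ⟨⟨s, hs⟩, basisCode_eq_true.2 hsW, hys⟩
  · rintro ⟨s, hs, hy⟩
    exact basisCode_eq_true.1 hs hy

theorem basisCode_injOn {b : Set (Set Y)} (hb : IsTopologicalBasis b) :
    InjOn (basisCode b) {W | IsOpen W} := by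
  intro W hW W' hW' h
  ext y
  rw [mem_iff_exists_basisCode hb hW, mem_iff_exists_basisCode hb hW', h]

/-- If every rejected basis set contains arbitrarily small rejected basis sets, then it contains a
point all of whose small neighbourhoods are rejected. -/
theorem exists_mem_forall_eq_false {Y : Type*} [MetricSpace Y] [CompleteSpace Y]
    {b : Set (Set Y)} (hb : IsTopologicalBasis b) (hne : ∀ s ∈ b, s.Nonempty) {x : b → Bool}
    (hmono : ∀ s t : b, (s : Set Y) ⊆ t → x t = true → x s = true)
    (hsmall : ∀ (s : b) (k : ℕ), x s = true ∨ ∃ t : b, x t = false ∧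
      closure (t : Set Y) ⊆ s ∧ ∀ y ∈ (t : Set Y), ∀ z ∈ (t : Set Y), dist y z ≤ 1 / ((k : ℝ) + 1))
    {s : b} (hs : x s = false) :
    ∃ p ∈ (s : Set Y), ∀ t : b, p ∈ (t : Set Y) → x t = false := by
  have step : ∀ (k : ℕ) (s : {s // x s = false}), ∃ t : {s // x s = false},
      closure (t : Set Y) ⊆ s.1 ∧
      ∀ y ∈ (t : Set Y), ∀ z ∈ (t : Set Y), dist y z ≤ 1 / ((k : ℝ) + 1) := by
    intro k s
    obtain ⟨t, ht, h⟩ := (hsmall s.1 k).resolve_left (by simp [s.2])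
    exact ⟨⟨t, ht⟩, h⟩
  choose next hcl hd using step
  -- The closures nest and the diameters shrink, so completeness gives a common point. A basis set
  -- around it contains some `T (n + 1)`, so by monotonicity it is rejected too.
  let T : ℕ → {s // x s = false} := fun n => n.rec ⟨s, hs⟩ next
  have hTcl : ∀ n, closure ((T (n + 1)).1 : Set Y) ⊆ (T n).1 := fun n => hcl n (T n)
  have hTd : ∀ n, ∀ y ∈ ((T (n + 1)).1 : Set Y), ∀ z ∈ ((T (n + 1)).1 : Set Y),
      dist y z ≤ 1 / ((n : ℝ) + 1) := fun n => hd n (T n)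
  have hTanti : Antitone fun n => ((T n).1 : Set Y) :=
    antitone_nat_of_succ_le fun n => subset_closure.trans (hTcl n)
  choose p hp using fun n => hne _ (T n).1.2
  have hcauchy : CauchySeq fun n => p (n + 1) :=
    cauchySeq_of_le_tendsto_0 (fun n : ℕ => 1 / ((n : ℝ) + 1))
      (fun n m N hn hm => hTd N _ (hTanti (Nat.succ_le_succ hn) (hp (n + 1))) _
        (hTanti (Nat.succ_le_succ hm) (hp (m + 1)))) tendsto_one_div_add_atTop_nhds_zero_nat
  obtain ⟨q, hq⟩ := cauchySeq_tendsto_of_complete hcauchy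
  have hqT : ∀ n, q ∈ ((T n).1 : Set Y) := by
    intro n
    refine hTcl n (mem_closure_of_tendsto hq ?_)
    filter_upwards [eventually_ge_atTop n] with m hm
    exact hTanti (show n + 1 ≤ m + 1 by omega) (hp (m + 1))
  refine ⟨q, hqT 0, fun t hqt => ?_⟩
  obtain ⟨ε, hε, hball⟩ := Metric.isOpen_iff.1 (hb.isOpen t.2) q hqt
  obtain ⟨n, hn⟩ := exists_nat_one_div_lt hε
  by_contra h
  have hsub : ((T (n + 1)).1 : Set Y) ⊆ t := fun z hz =>
    hball ((hTd n z hz q (hqT (n + 1))).trans_lt hn)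
  simpa [(T (n + 1)).2] using hmono _ _ hsub (by simpa using h)

/-- Codes are the monotone `x` for which each rejected `s` contains arbitrarily small rejected `t`
with closure in `s`. For a code, regularity finds `t` around a point of `s \ W`; conversely,
completeness yields a point of `s` outside every accepted set. Each clause is open in `x`, and there
are countably many. -/
theorem isGδ_openCodes {Y : Type*} [TopologicalSpace Y] [PolishSpace Y] {b : Set (Set Y)}
    (hbc : b.Countable) (hb : IsTopologicalBasis b) (hne : ∀ s ∈ b, s.Nonempty) :
    IsGδ (openCodes b) := by
  let := upgradeIsCompletelyMetrizable Y
  have := hbc.to_subtype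
  have hopen : ∀ (s : b) (c : Bool), IsOpen {x : b → Bool | x s = c} := fun s c =>
    (continuous_apply (A := fun _ : b => Bool) s).isOpen_preimage {c} (isOpen_discrete _)
  have key : openCodes b = (⋂ (s : b) (t : b), {x | (s : Set Y) ⊆ t → x t = true → x s = true}) ∩
      ⋂ (s : b) (k : ℕ), {x | x s = true ∨ ∃ t : b, x t = false ∧ closure (t : Set Y) ⊆ s ∧
        ∀ y ∈ (t : Set Y), ∀ z ∈ (t : Set Y), dist y z ≤ 1 / ((k : ℝ) + 1)} := by
    ext x
    simp only [mem_inter_iff, mem_iInter, mem_ofPred_eq]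
    constructor
    · rintro ⟨W, hW, rfl⟩
      refine ⟨fun s t hst ht => ?_, fun s k => ?_⟩
      · rw [basisCode_eq_true] at ht ⊢
        exact hst.trans ht
      · simp only [basisCode_eq_true, basisCode_eq_false]
        by_contra! h
        obtain ⟨hs, h⟩ := h
        obtain ⟨p, hps, hpW⟩ := not_subset.1 hs
        have hk : 0 < 1 / ((k : ℝ) + 1) / 2 := by positivity
        obtain ⟨F, ⟨hFp, hFcl⟩, hFs⟩ := (closed_nhds_basis p).mem_iff.1
          (inter_mem ((hb.isOpen s.2).mem_nhds hps) (Metric.ball_mem_nhds p hk))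
        obtain ⟨t, ht, hpt, htF⟩ := hb.mem_nhds_iff.1 hFp
        obtain ⟨y, hy, z, hz, hyz⟩ := h ⟨t, ht⟩ (fun h => hpW (h hpt))
          ((closure_minimal htF hFcl).trans (hFs.trans inter_subset_left))
        have h1 := Metric.mem_ball.1 (hFs (htF hy)).2
        have h2 := Metric.mem_ball.1 (hFs (htF hz)).2
        linarith [dist_triangle_right y z p]
    · rintro ⟨hmono, hsmall⟩
      refine ⟨⋃ s : {s : b // x s = true}, (s.1 : Set Y), isOpen_iUnion fun s => hb.isOpen s.1.2,
        funext fun s => ?_⟩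
      cases hs : x s
      · obtain ⟨p, hps, hp⟩ := exists_mem_forall_eq_false hb hne hmono hsmall hs
        refine basisCode_eq_false.2 fun h => ?_
        obtain ⟨t, ht⟩ := mem_iUnion.1 (h hps)
        simpa [t.2] using hp t.1 ht
      · exact basisCode_eq_true.2
          (subset_iUnion (fun s : {s : b // x s = true} => (s.1 : Set Y)) ⟨s, hs⟩)
  rw [key]
  refine (IsGδ.iInter fun s => IsGδ.iInter fun t => IsOpen.isGδ ?_).inter
    (IsGδ.iInter fun s => IsGδ.iInter fun k => IsOpen.isGδ ?_)
  · have : {x : b → Bool | (s : Set Y) ⊆ t → x t = true → x s = true} =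
        {x | ¬ (s : Set Y) ⊆ t} ∪ ({x | x t = false} ∪ {x | x s = true}) := by
      ext x
      simp only [mem_union, mem_ofPred_eq, ← Bool.not_eq_true]
      tauto
    rw [this]
    exact isOpen_const.union ((hopen _ _).union (hopen _ _))
  · rw [ofPred_or]
    refine (hopen _ _).union ?_
    rw [ofPred_exists]
    refine isOpen_iUnion fun t => ?_
    exact (hopen _ _).inter isOpen_const

/-- A neighbourhood of a code constrains only finitely many basis sets `I`, so it suffices to alter
`W` without changing which members of `I` it contains. -/
theorem perfectSpace_openCodes [T1Space Y] {b : Set (Set Y)} (hb : IsTopologicalBasis b)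
    (hfin : ∀ t ⊆ b, t.Finite → ⋃₀ t ≠ univ) : PerfectSpace (openCodes b) := by
  refine ⟨preperfect_iff_nhds.2 ?_⟩
  rintro ⟨_, W, hW, rfl⟩ - N hN
  obtain ⟨O, hO, hON⟩ := (mem_nhds_induced _ _ _).1 hN
  obtain ⟨O', hO'O, hO', hWO'⟩ := mem_nhds_iff.1 hO
  obtain ⟨I, u, hu, huO⟩ := isOpen_pi_iff.1 hO' _ hWO'
  suffices h : ∃ W', IsOpen W' ∧ W' ≠ W ∧ ∀ i ∈ I, (i : Set Y) ⊆ W' ↔ (i : Set Y) ⊆ W by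
    obtain ⟨W', hW', hne, hI⟩ := h
    refine ⟨⟨basisCode b W', W', hW', rfl⟩, ⟨hON (hO'O (huO fun i hi => ?_)), mem_univ _⟩,
      fun h => hne (basisCode_injOn hb hW' hW (congrArg Subtype.val h))⟩
    have : basisCode b W' i = basisCode b W i := by
      rw [Bool.eq_iff_iff, basisCode_eq_true, basisCode_eq_true, hI i hi]
    change basisCode b W' i ∈ u i
    rw [this]
    exact (hu i hi).2
  set J : Set (Set Y) := (fun i : b => (i : Set Y)) '' {i | i ∈ I ∧ (i : Set Y) ⊆ W} with hJ
  have hJb : J ⊆ b := by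
    rintro _ ⟨i, -, rfl⟩
    exact i.2
  have hJf : J.Finite := (I.finite_toSet.subset fun i hi => hi.1).image _
  -- If the members of `I` inside `W` cover it, enlarge `W` to the complement of finitely many
  -- points, one from each other member of `I`. Otherwise delete an uncovered point of `W`.
  by_cases hWJ : W ⊆ ⋃₀ J
  · have hp : ∀ i : b, ∃ p, ¬ (i : Set Y) ⊆ W → p ∈ (i : Set Y) \ W := by
      intro i
      by_cases hi : (i : Set Y) ⊆ W
      · obtain ⟨y, -⟩ := (ne_univ_iff_exists_notMem _).1 (hfin J hJb hJf)
        exact ⟨y, fun h => absurd hi h⟩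
      · obtain ⟨p, hp⟩ := not_subset.1 hi
        exact ⟨p, fun _ => hp⟩
    choose p hp using hp
    set F : Set Y := p '' {i | i ∈ I ∧ ¬ (i : Set Y) ⊆ W} with hF
    have hFf : F.Finite := (I.finite_toSet.subset fun i hi => hi.1).image _
    have hFW : W ⊆ Fᶜ := by
      rintro y hy ⟨i, hi, rfl⟩
      exact (hp i hi.2).2 hy
    refine ⟨Fᶜ, hFf.isClosed.isOpen_compl, fun h => ?_, fun i hi => ⟨fun h => ?_,
      fun h => h.trans hFW⟩⟩
    -- If `W = Fᶜ`, then `J` and one basis set around each point of `F` would be a finite cover of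
    -- `Y`.
    · choose B hB hyB using fun y : Y => hb.exists_subset_of_mem_open (mem_univ y) isOpen_univ
      refine hfin (J ∪ B '' F) (union_subset hJb (image_subset_iff.2 fun y _ => hB y))
        (hJf.union (hFf.image _)) (eq_univ_of_forall fun y => ?_)
      rw [sUnion_union]
      by_cases hy : y ∈ F
      · exact Or.inr ⟨B y, mem_image_of_mem _ hy, (hyB y).1⟩
      · exact Or.inl (hWJ (h ▸ hy))
    · by_contra hiW
      exact h (hp i hiW).1 ⟨i, ⟨hi, hiW⟩, rfl⟩
  · obtain ⟨q, hqW, hqJ⟩ := not_subset.1 hWJ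
    refine ⟨W \ {q}, hW.sdiff isClosed_singleton, fun h => (h.symm ▸ hqW : q ∈ W \ {q}).2 rfl,
      fun i hi => ⟨fun h => h.trans sdiff_subset, fun h => ?_⟩⟩
    exact subset_sdiff_singleton h fun hq => hqJ ⟨i, ⟨i, ⟨hi, h⟩, rfl⟩, hq⟩

end BasisCode

/-! ### The two implications -/

theorem HasUU.not_compactSpace {X Y : Type*} [TopologicalSpace X] [TopologicalSpace Y]
    [PerfectSpace X] (h : HasUU X Y) : ¬ CompactSpace Y := by
  intro hY
  obtain ⟨U, hU, huniq⟩ := h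
  obtain ⟨x, hx, hx'⟩ := huniq univ isOpen_univ
  have hsub : ({x} : Set X) ×ˢ (univ : Set Y) ⊆ U := by
    rintro ⟨a, y⟩ ⟨rfl, -⟩
    exact (hx.symm ▸ mem_univ y : y ∈ crossSection U a)
  obtain ⟨u, v, hu, -, hxu, hv, huv⟩ :=
    generalized_tube_lemma isCompact_singleton isCompact_univ hU hsub
  obtain ⟨a, ⟨hau, -⟩, hax⟩ := preperfect_iff_nhds.1 (PerfectSpace.univ_preperfect (α := X)) x
    (mem_univ x) u (hu.mem_nhds (singleton_subset_iff.1 hxu))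
  exact hax (hx' a (eq_univ_of_forall fun y => huv ⟨hau, hv (mem_univ y)⟩))

theorem hasUU_nat_nat_of_not_compactSpace {Y : Type*} [TopologicalSpace Y] [PolishSpace Y]
    (hY : ¬ CompactSpace Y) : HasUU (ℕ → ℕ) Y := by
  obtain ⟨b, hbc, hb, hne, hfin⟩ := exists_countable_basis_forall_finite_sUnion_ne_univ Y hY
  have := hbc.to_subtype
  have : IsCompletelyMetrizableSpace (b → Bool) := inferInstance
  have := (isGδ_openCodes hbc hb hne).polishSpace
  have := perfectSpace_openCodes hb hfin
  have : Nonempty (openCodes b) := ⟨_, univ, isOpen_univ, rfl⟩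
  obtain ⟨f, hfc, hfi, hfs⟩ := exists_nat_nat_continuous_bijective (openCodes b)
    (IsInducing.subtypeVal.isTopologicalBasis_isClopen isTopologicalBasis_isClopen)
  have hsec : ∀ {a : ℕ → ℕ} {W : Set Y}, IsOpen W → (f a).1 = basisCode b W →
      {y | ∃ s : b, (f a).1 s = true ∧ y ∈ (s : Set Y)} = W := by
    intro a W hW h
    ext y
    rw [mem_iff_exists_basisCode hb hW, mem_ofPred_eq, h]
  refine ⟨{p | ∃ s : b, (f p.1).1 s = true ∧ p.2 ∈ (s : Set Y)}, ?_, fun W hW => ?_⟩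
  · rw [ofPred_exists]
    refine isOpen_iUnion fun s => ?_
    have hs : IsOpen {a | (f a).1 s = true} :=
      (isOpen_discrete {true}).preimage
        ((continuous_apply s).comp (continuous_subtype_val.comp hfc))
    exact (hs.preimage continuous_fst).inter ((hb.isOpen s.2).preimage continuous_snd)
  · obtain ⟨a, ha⟩ := hfs ⟨_, W, hW, rfl⟩
    refine ⟨a, hsec hW (congrArg Subtype.val ha), fun c hc => hfi ?_⟩
    obtain ⟨W', hW', hcW'⟩ := (f c).2
    have : W' = W := (hsec hW' hcW'.symm).symm.trans hc
    rw [ha]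
    exact Subtype.ext (by rw [← hcW', this])

instance PerfectSpace.nat_nat : PerfectSpace (ℕ → ℕ) := by
  refine ⟨preperfect_iff_nhds.2 fun x _ U hU => ?_⟩
  have h : Tendsto (fun n => Function.update x n (x n + 1)) atTop (𝓝 x) := by
    rw [tendsto_pi_nhds]
    intro i
    apply tendsto_const_nhds.congr'
    filter_upwards [eventually_gt_atTop i] with n hn
    rw [Function.update_of_ne hn.ne]
  obtain ⟨n, hn⟩ := (h.eventually_mem hU).exists
  exact ⟨_, ⟨hn, mem_univ _⟩, fun h => by simpa using congrFun h n⟩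

theorem mainTheorem1 (Y : Type*) [TopologicalSpace Y] [PolishSpace Y] :
    HasUU (ℕ → ℕ) Y ↔ ¬ CompactSpace Y :=
  ⟨HasUU.not_compactSpace, hasUU_nat_nat_of_not_compactSpace⟩
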